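/- Let $\mathbb H[q_1,q_2]$ be the ring of slice regular polynomials in two quaternionic variables, i.e. of the functions $\mathbb H^2\to\mathbb H$ of the form $\sum_{n,m} q_1^n q_2^m a_{n,m}$ (finite sums, $a_{n,m}\in\mathbb H$), with pointwise addition and the product $$\Big(\sum q_1^nq_2^m a_{n,m}\Big)*\Big(\sum q_1^nq_2^m b_{n,m}\Big)=\sum_{n,m} q_1^nq_2^m\sum_{r\le n,\ s\le m}a_{r,s}b_{n-r,m-s}.$$ Let $P,Q\in\mathbb H[q_1,q_2]$ be nonzero, $n=\deg_{q_1}P$, $m=\deg_{q_1}Q$, and write $P=\sum_{k=0}^n q_1^kP_k(q_2)$, $Q=\sum_{k=0}^m q_1^kQ_k(q_2)$ with $P_k,Q_k\in\mathbb H[q_2]$. Let $A(q_2)$ be the $(n+m)\times(n+m)$ Sylvester matrix whose first $m$ columns are $(P_0,\dots,P_n,0,\dots,0)^t$ shifted down by $0,\dots,m-1$ places and whose last $n$ columns are $(Q_0,\dots,Q_m,0,\dots,0)^t$ shifted down by $0,\dots,n-1$ places. Let $\mathcal L(\mathbb H)$ be the classical skew field of $*$-quotients of the ring of slice regular functions on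 $\mathbb H$ (everywhere convergent power series $\sum q^na_n$ with $(\sum q^na_n)*(\sum q^nb_n)=\sum q^n\sum_{k\le n}a_kb_{n-k}$). The regular resultant ${\rm Res}(P,Q;q_1)$ is the Dieudonné determinant of $A(q_2)$ over $\mathcal L(\mathbb H)$; it takes values in the abelianization of $\mathcal L(\mathbb H)\setminus\{0\}$ together with the class of $0$, which is its value on non-invertible matrices (the determinant of the $0\times 0$ matrix is $1$). Exchanging the roles of the two variables, i.e. writing $P=\sum_k q_2^k*\tilde P_k(q_1)$ and $Q=\sum_k q_2^k*\tilde Q_k(q_1)$ with $\tilde P_k,\tilde Q_k\in\mathbb H[q_1]$ and using the degrees in $q_2$, one defines ${\rm Res}(P,Q;q_2)$. Then: 1. ${\rm Res}(P,Q;q_1)\equiv 0$ if and only if there exist nonzero $H,K\in\mathbb H[q_1,q_2]$ with $\deg_{q_1}H<\deg_{q_1}Q$, $\deg_{q_1}K<\deg_{q_1}P$ and $P*H+Q*K\equiv 0$. 2. ${\rm Res}(P,Q;q_2)\equiv 0$ if and only if there exist nonzero $\tilde H,\tilde K\in\mathbb H[q_1,q_2]$ with $\deg_{q_2}\tilde H<\deg_{q_2}Q$,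 $\deg_{q_2}\tilde K<\deg_{q_2}P$ and $P*\tilde H+Q*\tilde K\equiv 0$. -/

import Mathlib

open scoped Quaternion nonZeroDivisors

noncomputable section

/-! ### Slice regular polynomials in two quaternionic variables -/

/-- The function `(q₁, q₂) ↦ ∑ q₁ⁿ q₂ᵐ a_{n,m}` attached to a finitely supported family of
quaternionic coefficients (written on the right). -/
def sliceEval (a : AddMonoidAlgebra ℍ[ℝ] (ℕ × ℕ)) (q₁ q₂ : ℍ[ℝ]) : ℍ[ℝ] :=
  a.coeff.sum fun nm c => q₁ ^ nm.1 * q₂ ^ nm.2 * c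

theorem real_family_eq_zero (f : ℕ × ℕ →₀ ℝ)
    (h : ∀ x y : ℝ, (f.sum fun nm c => x ^ nm.1 * y ^ nm.2 * c) = 0) : f = 0 := by
  classical
  let e : ℕ × ℕ → (Fin 2 →₀ ℕ) := fun nm => Finsupp.equivFunOnFinite.symm ![nm.1, nm.2]
  have he : Function.Injective e := by
    intro a b hab
    have h0 := DFunLike.congr_fun hab 0
    have h1 := DFunLike.congr_fun hab 1
    simp [e] at h0 h1
    exact Prod.ext h0 h1
  let F : MvPolynomial (Fin 2) ℝ := f.sum fun nm c => MvPolynomial.monomial (e nm) c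
  have hF : F = 0 := by
    apply MvPolynomial.funext
    intro v
    have := h (v 0) (v 1)
    simp only [F, Finsupp.sum, map_sum, MvPolynomial.eval_monomial, map_zero] at this ⊢
    rw [← this]
    refine Finset.sum_congr rfl fun nm _ => ?_
    rw [Finsupp.prod_fintype _ _ (by simp)]
    simp [e, Fin.prod_univ_two]
    ring
  ext nm
  have hc := congrArg (MvPolynomial.coeff (e nm)) hF
  simp only [F, Finsupp.sum, MvPolynomial.coeff_sum, MvPolynomial.coeff_monomial,
    MvPolynomial.coeff_zero, he.eq_iff] at hc
  simpa using hc

/-- Identity principle: the coefficients are determined by the function. -/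
theorem sliceEval_injective : Function.Injective sliceEval := by
  intro a b hab
  have key : ∀ φ : ℍ[ℝ] →ₗ[ℝ] ℝ, ∀ nm, φ (a.coeff nm) = φ (b.coeff nm) := by
    intro φ nm
    have hz : (a.coeff - b.coeff).mapRange φ (map_zero φ) = 0 := by
      apply real_family_eq_zero
      intro x y
      have h1 := congrFun (congrFun hab (x : ℍ[ℝ])) (y : ℍ[ℝ])
      have h2 : ((a.coeff - b.coeff).sum fun nm c =>
          (x : ℍ[ℝ]) ^ nm.1 * (y : ℍ[ℝ]) ^ nm.2 * c) = 0 := by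
        rw [Finsupp.sum_sub_index (by intros; rw [mul_sub])]
        exact sub_eq_zero.mpr h1
      have h3 := congrArg φ h2
      rw [Finsupp.sum_mapRange_index (by simp)]
      rw [Finsupp.sum, map_sum, map_zero] at h3
      rw [Finsupp.sum, ← h3]
      refine Finset.sum_congr rfl fun nm _ => ?_
      rw [← Quaternion.coe_pow, ← Quaternion.coe_pow, ← Quaternion.coe_mul,
        Quaternion.coe_mul_eq_smul, map_smul, smul_eq_mul]
    have := DFunLike.congr_fun hz nm
    simpa [sub_eq_zero] using this
  ext nm
  all_goals first
    | exact key (QuaternionAlgebra.reₗ _ _ _) nm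
    | exact key (QuaternionAlgebra.imIₗ _ _ _) nm
    | exact key (QuaternionAlgebra.imJₗ _ _ _) nm
    | exact key (QuaternionAlgebra.imKₗ _ _ _) nm

/-- `ℍ[q₁, q₂]`: the functions `ℍ² → ℍ` of the form `∑ q₁ⁿ q₂ᵐ a_{n,m}` (finite sums). -/
def SlicePoly₂ : Type := Set.range sliceEval

namespace SlicePoly₂

/-- A slice regular polynomial and its family of coefficients determine each other. -/
def ofCoeffs : AddMonoidAlgebra ℍ[ℝ] (ℕ × ℕ) ≃ SlicePoly₂ :=
  Equiv.ofInjective sliceEval sliceEval_injective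

/-- Pointwise addition and the `*`-product `∑ q₁ⁿ q₂ᵐ ∑_{r ≤ n, s ≤ m} a_{r,s} b_{n-r,m-s}`,
that is, convolution of the coefficients. -/
instance : Ring SlicePoly₂ := ofCoeffs.symm.ring

/-- The coefficient `a_{n,m}` of `q₁ⁿ q₂ᵐ`. -/
def coeff (P : SlicePoly₂) (n m : ℕ) : ℍ[ℝ] := (ofCoeffs.symm P).coeff (n, m)

/-- `deg_{q₁} P`, the largest `n` with some `a_{n,m} ≠ 0` (and `0` if `P = 0`). -/
def degQ₁ (P : SlicePoly₂) : ℕ := (ofCoeffs.symm P).coeff.support.sup Prod.fst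

/-- `deg_{q₂} P`, the largest `m` with some `a_{n,m} ≠ 0` (and `0` if `P = 0`). -/
def degQ₂ (P : SlicePoly₂) : ℕ := (ofCoeffs.symm P).coeff.support.sup Prod.snd

/-- `P_k(q₂) = ∑ₘ q₂ᵐ a_{k,m}` in `ℍ[q₂]`, so that `P = ∑ₖ q₁ᵏ * P_k(q₂)`. -/
def coeffQ₁ (P : SlicePoly₂) (k : ℕ) : Polynomial ℍ[ℝ] :=
  ∑ m ∈ Finset.range (P.degQ₂ + 1), Polynomial.monomial m (P.coeff k m)

/-- `P̃_k(q₁) = ∑ₙ q₁ⁿ a_{n,k}` in `ℍ[q₁]`, so that `P = ∑ₖ q₂ᵏ * P̃_k(q₁)`. -/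
def coeffQ₂ (P : SlicePoly₂) (k : ℕ) : Polynomial ℍ[ℝ] :=
  ∑ n ∈ Finset.range (P.degQ₁ + 1), Polynomial.monomial n (P.coeff n k)

end SlicePoly₂

/-! ### Entire slice regular functions and their skew field of quotients -/

theorem summable_slice_iff (f : PowerSeries ℍ[ℝ]) (q : ℍ[ℝ]) :
    (Summable fun n => q ^ n * PowerSeries.coeff n f) ↔
      Summable fun n => ‖q ^ n * PowerSeries.coeff n f‖ :=
  summable_norm_iff.symm

theorem summable_slice_mul (f g : PowerSeries ℍ[ℝ]) (q : ℍ[ℝ])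
    (hf : Summable fun n => q ^ n * PowerSeries.coeff n f)
    (hg : Summable fun n => q ^ n * PowerSeries.coeff n g) :
    Summable fun n => q ^ n * PowerSeries.coeff n (f * g) := by
  have h1 := (summable_slice_iff f q).1 hf
  have h2 := (summable_slice_iff g q).1 hg
  have hp : Summable fun kl : ℕ × ℕ => ‖q ^ kl.1 * PowerSeries.coeff kl.1 f‖ *
      ‖q ^ kl.2 * PowerSeries.coeff kl.2 g‖ :=
    h1.mul_of_nonneg h2 (fun _ => norm_nonneg _) (fun _ => norm_nonneg _)
  have hs : Summable fun n => ∑ kl ∈ Finset.HasAntidiagonal.antidiagonal n,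
      ‖q ^ kl.1 * PowerSeries.coeff kl.1 f‖ * ‖q ^ kl.2 * PowerSeries.coeff kl.2 g‖ :=
    summable_sum_mul_antidiagonal_of_summable_mul (A := ℕ)
      (f := fun n => ‖q ^ n * PowerSeries.coeff n f‖)
      (g := fun n => ‖q ^ n * PowerSeries.coeff n g‖) hp
  refine Summable.of_norm_bounded hs fun n => ?_
  rw [PowerSeries.coeff_mul, Finset.mul_sum]
  refine (norm_sum_le _ _).trans (Finset.sum_le_sum fun kl hkl => ?_)
  rw [← Finset.HasAntidiagonal.mem_antidiagonal.1 hkl]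
  simp only [norm_mul, norm_pow, pow_add]
  exact le_of_eq (by ring)

/-- The ring `𝒮ℛ(ℍ)` of slice regular functions on the whole of `ℍ`: the power series
`∑ qⁿ aₙ` that converge at every `q`, with the `*`-product `∑ qⁿ ∑ₖ aₖ b_{n-k}`. -/
def EntireSlice : Subring (PowerSeries ℍ[ℝ]) where
  carrier := {f | ∀ q : ℍ[ℝ], Summable fun n => q ^ n * PowerSeries.coeff n f}
  zero_mem' q := by simp [summable_zero]
  one_mem' q := by
    apply summable_of_ne_finset_zero (s := {0})
    intro n hn
    simp [PowerSeries.coeff_one, Finset.mem_singleton.not.mp hn]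
  add_mem' {f g} hf hg q := by simpa [mul_add] using (hf q).add (hg q)
  neg_mem' {f} hf q := by simpa using (hf q).neg
  mul_mem' {f g} hf hg q := summable_slice_mul f g q (hf q) (hg q)

namespace EntireSlice

/-- The regular conjugate `∑ qⁿ āₙ`. -/
def conj (f : EntireSlice) : EntireSlice :=
  ⟨PowerSeries.mk fun n => star (PowerSeries.coeff n f.1), fun q => by
    rw [summable_slice_iff]
    simpa using (summable_slice_iff f.1 q).1 (f.2 q)⟩

/-- The symmetrization has real coefficients. -/
theorem coeff_conj_mul_self (f : EntireSlice) (n : ℕ) :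
    ∃ r : ℝ, PowerSeries.coeff n ((conj f * f : EntireSlice) : PowerSeries ℍ[ℝ]) = r := by
  have h : star (PowerSeries.coeff n ((conj f * f : EntireSlice) : PowerSeries ℍ[ℝ])) =
      PowerSeries.coeff n ((conj f * f : EntireSlice) : PowerSeries ℍ[ℝ]) := by
    simp only [conj, Subring.coe_mul, PowerSeries.coeff_mul, PowerSeries.coeff_mk, star_sum,
      star_mul, star_star]
    rw [← Finset.Nat.sum_antidiagonal_swap]
    rfl
  exact ⟨_, Quaternion.star_eq_self.1 h⟩

theorem conj_mul_self_comm (f g : EntireSlice) : conj f * f * g = g * (conj f * f) := by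
  apply Subtype.ext
  ext1 n
  rw [Subring.coe_mul (EntireSlice) (conj f * f) g, Subring.coe_mul (EntireSlice) g (conj f * f),
    PowerSeries.coeff_mul, PowerSeries.coeff_mul, ← Finset.Nat.sum_antidiagonal_swap]
  refine Finset.sum_congr rfl fun kl _ => ?_
  obtain ⟨r, hr⟩ := coeff_conj_mul_self f kl.2
  simp only [Prod.fst_swap, Prod.snd_swap]
  rw [hr]
  exact Quaternion.coe_commutes r _

/-- `𝒮ℛ(ℍ)` is an Ore domain. -/
instance : OreLocalization.OreSet EntireSlice⁰ :=
  Classical.choice <| OreLocalization.nonempty_oreSet_iff_of_noZeroDivisors.2 fun r s => by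
    have hs : (s : EntireSlice) ≠ 0 := nonZeroDivisors.ne_zero s.2
    have hc : conj (s : EntireSlice) ≠ 0 := by
      intro h
      apply hs
      apply Subtype.ext
      ext1 n
      have := congrArg (fun f : EntireSlice => PowerSeries.coeff n f.1) h
      simpa [conj] using this
    exact ⟨r * conj s, ⟨conj s * s, mem_nonZeroDivisors_of_ne_zero (mul_ne_zero hc hs)⟩, by
      simpa [mul_assoc] using conj_mul_self_comm (s : EntireSlice) r⟩

/-- A slice regular polynomial `∑ qⁿ aₙ` in one variable is an entire slice regular function. -/
def ofPolynomial : Polynomial ℍ[ℝ] →+* EntireSlice :=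
  Polynomial.coeToPowerSeries.ringHom.codRestrict EntireSlice fun p q => by
    apply summable_of_ne_finset_zero (s := p.support)
    intro n hn
    simp [Polynomial.notMem_support_iff.1 hn]

end EntireSlice

/-- `ℒ(ℍ)`: the skew field of left `*`-quotients `f^{-*} * g` of entire slice regular
functions, the classical ring of quotients of `𝒮ℛ(ℍ)`. -/
abbrev SemiRegular : Type := OreLocalization EntireSlice⁰ EntireSlice

/-- The inclusion of the slice regular polynomials in one variable into `ℒ(ℍ)`. -/
def SemiRegular.ofPolynomial : Polynomial ℍ[ℝ] →+* SemiRegular :=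
  OreLocalization.numeratorRingHom.comp EntireSlice.ofPolynomial

/-! ### The Dieudonné determinant -/

/-- The abelian quotient of a skew field `F`: the abelianization of `Fˣ`, together with the
class of `0`. -/
abbrev AbQuot (F : Type*) [DivisionRing F] : Type _ := WithZero (Abelianization Fˣ)

open Classical in
/-- The class `[x]` of `x ∈ F` in the abelian quotient. -/
def AbQuot.mk {F : Type*} [DivisionRing F] (x : F) : AbQuot F :=
  if h : x = 0 then 0 else (Abelianization.of (Units.mk0 x h) : Abelianization Fˣ)

open Classical in
/-- The Dieudonné determinant, by recursion on the size. If the first column is zero, it is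
`[0]`. Otherwise pick a nonzero entry `a_{k1}` of the first column, subtract from each row `i ≠ k`
the left multiple `a_{i1} a_{k1}⁻¹` of row `k`, delete row `k` and the first column, and multiply
the determinant of what remains by `[± a_{k1}]`. The sign comes from moving row `k` to the top; it
makes the result independent of `k` over every skew field, and it is invisible over `ℒ(ℍ)`, where
`-1 = i j i⁻¹ j⁻¹` is a commutator. -/
def dieudonneDet {F : Type*} [DivisionRing F] :
    (n : ℕ) → Matrix (Fin n) (Fin n) F → AbQuot F
  | 0, _ => 1
  | n + 1, A =>
    if h : ∃ k, A k 0 ≠ 0 then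
      let k := h.choose
      AbQuot.mk ((-1) ^ (k : ℕ) * A k 0) *
        dieudonneDet n (Matrix.of fun i j =>
          A (k.succAbove i) j.succ - A (k.succAbove i) 0 * (A k 0)⁻¹ * A k j.succ)
    else 0

/-! ### Regular resultants -/

/-- The Sylvester matrix of two sequences of coefficients `P₀, P₁, …` and `Q₀, Q₁, …`: the first
`m` columns are `(P₀, P₁, …)` shifted down by `0, …, m - 1`, the last `n` columns are
`(Q₀, Q₁, …)` shifted down by `0, …, n - 1`. Here `n` and `m` are the degrees of `P` and `Q`. -/
def sylvesterMatrix {R : Type*} [Zero R] (n m : ℕ) (P Q : ℕ → R) :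
    Matrix (Fin (m + n)) (Fin (m + n)) R :=
  Matrix.of fun i j => Fin.addCases (motive := fun _ => R)
    (fun p : Fin m => if (p : ℕ) ≤ i then P (i - p) else 0)
    (fun p : Fin n => if (p : ℕ) ≤ i then Q (i - p) else 0) j

namespace SlicePoly₂

/-- The regular resultant `Res(P, Q; q₁)`, the Dieudonné determinant over `ℒ(ℍ)` of the Sylvester
matrix with entries in `ℍ[q₂]`. -/
def resQ₁ (P Q : SlicePoly₂) : AbQuot SemiRegular :=
  dieudonneDet _ ((sylvesterMatrix P.degQ₁ Q.degQ₁ P.coeffQ₁ Q.coeffQ₁).map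
    SemiRegular.ofPolynomial)

/-- The regular resultant `Res(P, Q; q₂)`, the Dieudonné determinant over `ℒ(ℍ)` of the Sylvester
matrix with entries in `ℍ[q₁]`. -/
def resQ₂ (P Q : SlicePoly₂) : AbQuot SemiRegular :=
  dieudonneDet _ ((sylvesterMatrix P.degQ₂ Q.degQ₂ P.coeffQ₂ Q.coeffQ₂).map
    SemiRegular.ofPolynomial)

end SlicePoly₂

end

open scoped Quaternion nonZeroDivisors

noncomputable section

/-! Order the coefficients of `H` and `K` into one vector. The Sylvester matrix sends it to the
coefficients of `P * H + Q * K` (`sylvesterMatrix_mulVec`), so low degree syzygies are right null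
vectors with polynomial entries. In a domain, with `P` and `Q` nonzero, `H` and `K` vanish together,
so a nonzero vector makes both nonzero.

Gaussian elimination shows that the Dieudonné determinant vanishes exactly when a nonzero right null
vector exists over the skew field. The argument works for whichever pivots are chosen, so
independence of that choice is not needed.

What remains is to replace a null vector over `ℒ(ℍ)` by a polynomial one
(`dieudonneDet_map_eq_zero_iff`). A nonzero polynomial times its conjugate is central and nonzero,
so fractions of polynomials with central denominators form a skew subfield. It contains the matrix
entries, hence elimination stays inside it, and multiplying its null vector on the right by a common
denominator gives polynomial entries. -/

/-! ### Dieudonné determinants and null vectors. -/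

theorem AbQuot.mk_eq_zero_iff {F : Type*} [DivisionRing F] {x : F} :
    AbQuot.mk x = 0 ↔ x = 0 := by
  unfold AbQuot.mk
  split_ifs with h
  · simp [h]
  · simp only [h, iff_false]
    exact WithZero.coe_ne_zero

/-- A square matrix over a skew field with a nonzero right null vector has Dieudonné determinant
zero. -/
theorem dieudonneDet_eq_zero_of_mulVec {F : Type*} [DivisionRing F] :
    ∀ (n : ℕ) (A : Matrix (Fin n) (Fin n) F) (v : Fin n → F), v ≠ 0 → A.mulVec v = 0 →
      dieudonneDet n A = 0
  | 0, _, v, hv, _ => (hv (Subsingleton.elim _ _)).elim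
  | n + 1, A, v, hv, hA => by
    rw [dieudonneDet]
    split_ifs with h
    · have hk := h.choose_spec
      set k := h.choose
      have hrow : ∀ i, A i 0 * v 0 + ∑ j : Fin n, A i j.succ * v j.succ = 0 := fun i => by
        rw [← Fin.sum_univ_succ (fun j => A i j * v j)]
        exact congrFun hA i
      -- The pivot row determines `v 0` from the other entries, so the tail of `v` is nonzero and is
      -- killed by the reduced matrix.
      have h0 : v 0 = -((A k 0)⁻¹ * ∑ j : Fin n, A k j.succ * v j.succ) := by
        rw [← eq_neg_of_add_eq_zero_left (neg_add_cancel _), ← mul_neg,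
          ← eq_neg_of_add_eq_zero_left (hrow k), inv_mul_cancel_left₀ hk]
      simp only [mul_eq_zero]
      right
      refine dieudonneDet_eq_zero_of_mulVec n _ (fun j => v j.succ) ?_ ?_
      · intro hz
        have hz' : ∀ j : Fin n, v j.succ = 0 := fun j => congrFun hz j
        apply hv
        funext i
        refine Fin.cases ?_ (fun j => hz' j) i
        simp [h0, hz']
      · funext i
        have hi := hrow (k.succAbove i)
        rw [h0] at hi
        simp only [Matrix.mulVec, dotProduct, Matrix.of_apply, sub_mul, Finset.sum_sub_distrib,
          Pi.zero_apply]
        simp only [mul_assoc, ← Finset.mul_sum]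
        rw [← hi, mul_neg]
        abel
    · rfl

/-- If a matrix with entries in a sub-skew-field `S` has Dieudonné determinant zero, then it has a
nonzero right null vector with entries in `S`. -/
theorem exists_mulVec_eq_zero_of_dieudonneDet {F : Type*} [DivisionRing F] (S : Subring F)
    (hS : ∀ x ∈ S, x⁻¹ ∈ S) :
    ∀ (n : ℕ) (A : Matrix (Fin n) (Fin n) F), (∀ i j, A i j ∈ S) → dieudonneDet n A = 0 →
      ∃ v : Fin n → F, v ≠ 0 ∧ (∀ i, v i ∈ S) ∧ A.mulVec v = 0
  | 0, _, _, h => by simp [dieudonneDet] at h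
  | n + 1, A, hA, hdet => by
    rw [dieudonneDet] at hdet
    split_ifs at hdet with h
    · have hk := h.choose_spec
      set k := h.choose
      -- The pivot factor is nonzero, so the determinant of the reduced matrix must vanish.
      simp only [mul_eq_zero, AbQuot.mk_eq_zero_iff, hk, pow_eq_zero_iff', neg_eq_zero,
        one_ne_zero, false_and, or_false, false_or] at hdet
      obtain ⟨w, hw, hwS, hBw⟩ := exists_mulVec_eq_zero_of_dieudonneDet S hS n _ (fun i j =>
        S.sub_mem (hA _ _) (S.mul_mem (S.mul_mem (hA _ _) (hS _ (hA _ _))) (hA _ _))) hdet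
      set t := ∑ j : Fin n, A k j.succ * w j with ht
      -- The new first entry solves the pivot row; the other rows then reduce to the null equation
      -- for `w`.
      refine ⟨Fin.cons (-((A k 0)⁻¹ * t)) w, ?_, ?_, ?_⟩
      · intro hz
        exact hw (funext fun j => by simpa using congrFun hz j.succ)
      · refine Fin.cases ?_ fun j => by simp [hwS j]
        simpa using S.mul_mem (hS _ (hA _ _)) (S.sum_mem fun j _ => S.mul_mem (hA _ _) (hwS j))
      · funext i
        simp only [Matrix.mulVec, dotProduct, Fin.sum_univ_succ, Fin.cons_zero, Fin.cons_succ,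
          Pi.zero_apply]
        rcases Fin.eq_self_or_eq_succAbove k i with rfl | ⟨i, rfl⟩
        · rw [← ht, mul_neg, mul_inv_cancel_left₀ hk, neg_add_cancel]
        · have hi := congrFun hBw i
          simp only [Matrix.mulVec, dotProduct, sub_mul, Finset.sum_sub_distrib,
            Pi.zero_apply] at hi
          simp only [mul_assoc, ← Finset.mul_sum] at hi
          rw [← hi, mul_neg]
          abel
    · push Not at h
      -- The first column is zero, so the first basis vector is a null vector.
      refine ⟨Pi.single 0 1, by simp, fun i => ?_, ?_⟩
      · rcases eq_or_ne i 0 with rfl | hi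
        · simp
        · simp [hi]
      · funext i
        simp [Matrix.mulVec_single, h]

/-! ### Fractions with central denominators. -/

/-- The fractions `φ p * (φ c)⁻¹` with numerator in a domain `R` and nonzero central denominator. -/
def centralFractions {R F : Type*} [Ring R] [IsDomain R] [DivisionRing F] (φ : R →+* F) :
    Subring F where
  carrier := {x | ∃ c ∈ Subring.center R, c ≠ 0 ∧ ∃ p, x * φ c = φ p}
  zero_mem' := ⟨1, one_mem _, one_ne_zero, 0, by simp⟩
  one_mem' := ⟨1, one_mem _, one_ne_zero, 1, by simp⟩
  add_mem' := by
    rintro x y ⟨c, hc, hc0, p, hp⟩ ⟨d, hd, hd0, q, hq⟩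
    refine ⟨c * d, mul_mem hc hd, mul_ne_zero hc0 hd0, p * d + q * c, ?_⟩
    rw [map_add, map_mul φ p, map_mul φ q, ← hp, ← hq, mul_assoc, mul_assoc, ← map_mul,
      ← map_mul, Subring.mem_center_iff.1 hc d, ← add_mul]
  neg_mem' := by
    rintro x ⟨c, hc, hc0, p, hp⟩
    exact ⟨c, hc, hc0, -p, by rw [neg_mul, hp, map_neg]⟩
  mul_mem' := by
    rintro x y ⟨c, hc, hc0, p, hp⟩ ⟨d, hd, hd0, q, hq⟩
    -- Since `c` is central, `φ c` moves left past `φ q` to cancel the denominator of `x`.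
    refine ⟨d * c, mul_mem hd hc, mul_ne_zero hd0 hc0, p * q, ?_⟩
    rw [map_mul φ d, mul_assoc, ← mul_assoc y, hq, ← map_mul, Subring.mem_center_iff.1 hc q,
      map_mul, ← mul_assoc, hp, map_mul]

theorem map_mem_centralFractions {R F : Type*} [Ring R] [IsDomain R] [DivisionRing F]
    (φ : R →+* F) (p : R) : φ p ∈ centralFractions φ :=
  ⟨1, one_mem _, one_ne_zero, p, by simp⟩

/-- If every nonzero element has a nonzero central multiple, the fractions with central
denominators are closed under inversion. -/
theorem inv_mem_centralFractions {R F : Type*} [Ring R] [IsDomain R] [DivisionRing F]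
    (φ : R →+* F) (hφ : Function.Injective φ)
    (hR : ∀ p : R, p ≠ 0 → ∃ p' : R, p' ≠ 0 ∧ p * p' ∈ Subring.center R) :
    ∀ x ∈ centralFractions φ, x⁻¹ ∈ centralFractions φ := by
  rintro x ⟨c, hc, hc0, p, hp⟩
  rcases eq_or_ne x 0 with rfl | hx
  · simp
  have hcp : φ c = x⁻¹ * φ p := by rw [← hp, inv_mul_cancel_left₀ hx]
  have hp0 : p ≠ 0 := by
    rintro rfl
    exact hc0 (hφ (by simpa using hcp))
  obtain ⟨p', hp', hpp'⟩ := hR p hp0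
  -- From `φ c = x⁻¹ * φ p`, the denominator `p` of `x⁻¹` becomes central after right multiplication
  -- by `p'`.
  exact ⟨p * p', hpp', mul_ne_zero hp0 hp', c * p', by
    rw [map_mul, ← mul_assoc, ← hcp, map_mul]⟩

/-- Finitely many fractions with central denominators have a common one. -/
theorem exists_common_denominator {R F ι : Type*} [Ring R] [IsDomain R] [DivisionRing F]
    (φ : R →+* F) (v : ι → F) (hv : ∀ i, v i ∈ centralFractions φ) (s : Finset ι) :
    ∃ c ∈ Subring.center R, c ≠ 0 ∧ ∀ i ∈ s, ∃ p, v i * φ c = φ p := by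
  classical
  induction s using Finset.induction_on with
  | empty => exact ⟨1, one_mem _, one_ne_zero, by simp⟩
  | insert a s _ ih =>
    obtain ⟨c, hc, hc0, h⟩ := ih
    obtain ⟨d, hd, hd0, p, hp⟩ := hv a
    refine ⟨c * d, mul_mem hc hd, mul_ne_zero hc0 hd0, fun i hi => ?_⟩
    rcases Finset.mem_insert.1 hi with rfl | hi
    · exact ⟨p * c, by rw [← Subring.mem_center_iff.1 hc d, map_mul, ← mul_assoc, hp, map_mul]⟩
    · obtain ⟨q, hq⟩ := h i hi
      exact ⟨q * d, by rw [map_mul, ← mul_assoc, hq, map_mul]⟩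

/-- Over a domain whose nonzero elements have nonzero central multiples, the Dieudonné determinant
of a matrix vanishes over a skew field extension exactly when the matrix has a nonzero null vector
over the domain. -/
theorem dieudonneDet_map_eq_zero_iff {R F : Type*} [Ring R] [IsDomain R] [DivisionRing F]
    (φ : R →+* F) (hφ : Function.Injective φ)
    (hR : ∀ p : R, p ≠ 0 → ∃ p' : R, p' ≠ 0 ∧ p * p' ∈ Subring.center R)
    {n : ℕ} (A : Matrix (Fin n) (Fin n) R) :
    dieudonneDet n (A.map φ) = 0 ↔ ∃ w : Fin n → R, w ≠ 0 ∧ A.mulVec w = 0 := by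
  constructor
  · intro h
    obtain ⟨v, hv, hvS, hAv⟩ := exists_mulVec_eq_zero_of_dieudonneDet (centralFractions φ)
      (inv_mem_centralFractions φ hφ hR) n (A.map φ)
      (fun i j => map_mem_centralFractions φ (A i j)) h
    -- The matrix acts from the left, so scaling the null vector on the right by `φ c` keeps it
    -- null.
    obtain ⟨c, -, hc0, hc⟩ := exists_common_denominator φ v hvS Finset.univ
    choose w hw using fun i => hc i (Finset.mem_univ i)
    have hφc : φ c ≠ 0 := (map_ne_zero_iff φ hφ).2 hc0
    refine ⟨w, ?_, ?_⟩
    · rintro rfl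
      exact hv (funext fun i => by simpa [hφc] using hw i)
    · funext i
      apply hφ
      have hi := congrArg (· * φ c) (congrFun hAv i)
      simpa [Matrix.mulVec, dotProduct, Finset.sum_mul, mul_assoc, hw] using hi
  · rintro ⟨w, hw, hAw⟩
    refine dieudonneDet_eq_zero_of_mulVec n _ (fun i => φ (w i)) ?_ ?_
    · intro h
      exact hw (funext fun i => hφ (by simpa using congrFun h i))
    · funext i
      simpa [Matrix.mulVec, dotProduct] using congrArg φ (congrFun hAw i)

/-! ### Quaternionic polynomials inside `ℒ(ℍ)`. -/

theorem EntireSlice.ofPolynomial_injective : Function.Injective EntireSlice.ofPolynomial := by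
  intro p q h
  exact Polynomial.coe_injective ℍ[ℝ] (congrArg Subtype.val h)

theorem SemiRegular.ofPolynomial_injective : Function.Injective SemiRegular.ofPolynomial :=
  (OreLocalization.numeratorHom_inj (S := EntireSlice⁰) inf_le_left).comp EntireSlice.ofPolynomial_injective

/-- Every nonzero quaternionic polynomial has a nonzero central multiple, its symmetrization. -/
theorem exists_mul_mem_center (p : Polynomial ℍ[ℝ]) (hp : p ≠ 0) :
    ∃ p' : Polynomial ℍ[ℝ], p' ≠ 0 ∧ p * p' ∈ Subring.center (Polynomial ℍ[ℝ]) := by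
  let p' : Polynomial ℍ[ℝ] := ⟨.ofCoeff (p.toFinsupp.coeff.mapRange star (star_zero _))⟩
  have hcoeff : ∀ n, p'.coeff n = star (p.coeff n) := fun n => by
    simp [p', Polynomial.coeff]
  -- As `p` is the conjugate of `p'`, the product `p * p'` is the symmetrization of `p'`. It
  -- commutes with all entire functions, in particular with polynomials.
  have hconj : EntireSlice.conj (EntireSlice.ofPolynomial p') = EntireSlice.ofPolynomial p := by
    apply Subtype.ext
    ext1 n
    change PowerSeries.coeff n (PowerSeries.mk fun n => star (PowerSeries.coeff n
      (p' : PowerSeries ℍ[ℝ]))) = PowerSeries.coeff n (p : PowerSeries ℍ[ℝ])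
    simp [hcoeff]
  refine ⟨p', ?_, Subring.mem_center_iff.2 fun g => ?_⟩
  · rintro h
    apply hp
    ext1 n
    have := hcoeff n
    rw [h] at this
    simpa using this.symm
  · apply EntireSlice.ofPolynomial_injective
    have := EntireSlice.conj_mul_self_comm (EntireSlice.ofPolynomial p')
      (EntireSlice.ofPolynomial g)
    rw [hconj] at this
    simpa only [map_mul] using this.symm

/-! ### Sylvester matrices and syzygies. -/

-- This is one block of a Sylvester row. The test `p ≤ i` is essential: truncated subtraction would
-- otherwise put `P.coeff 0` where the shifted column has a zero.
open Polynomial in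
theorem Polynomial.coeff_mul_sum_monomial {R : Type*} [Semiring R] (P : R[X]) (m : ℕ)
    (h : Fin m → R) (i : ℕ) :
    (P * ∑ p : Fin m, monomial (p : ℕ) (h p)).coeff i =
      ∑ p : Fin m, (if (p : ℕ) ≤ i then P.coeff (i - p) else 0) * h p := by
  rw [Finset.mul_sum, finsetSum_coeff]
  refine Finset.sum_congr rfl fun p _ => ?_
  split_ifs with hp
  · conv_lhs => rw [← Nat.sub_add_cancel hp]
    rw [coeff_mul_monomial]
  · rw [← C_mul_X_pow_eq_monomial, ← mul_assoc, coeff_mul_X_pow', if_neg hp, zero_mul]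

open Polynomial in
theorem Polynomial.natDegree_sum_monomial_lt {R : Type*} [Semiring R] {m : ℕ} (h : Fin m → R)
    (h0 : ∑ p : Fin m, monomial (p : ℕ) (h p) ≠ 0) :
    (∑ p : Fin m, monomial (p : ℕ) (h p)).natDegree < m := by
  rw [natDegree_lt_iff_degree_lt h0, degree_lt_iff_coeff_zero]
  intro k hk
  rw [finsetSum_coeff]
  exact Finset.sum_eq_zero fun p _ => coeff_monomial_of_ne _ (by have := p.2; omega)

open Polynomial in
/-- The Sylvester matrix represents `(H, K) ↦ P * H + Q * K`. -/
theorem sylvesterMatrix_mulVec {R : Type*} [Ring R] (P Q : R[X]) (n m : ℕ)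
    (v : Fin (m + n) → R) (i : Fin (m + n)) :
    (sylvesterMatrix n m P.coeff Q.coeff).mulVec v i =
      (P * ∑ p : Fin m, monomial (p : ℕ) (v (Fin.castAdd n p)) +
        Q * ∑ p : Fin n, monomial (p : ℕ) (v (Fin.natAdd m p))).coeff i := by
  rw [coeff_add, coeff_mul_sum_monomial, coeff_mul_sum_monomial]
  simp [Matrix.mulVec, dotProduct, sylvesterMatrix, Fin.sum_univ_add]

open Polynomial in
/-- Over a domain, the Sylvester matrix of nonzero `P` and `Q` is singular exactly when `P` and `Q`
have a nontrivial right syzygy of low degree. -/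
theorem exists_sylvesterMatrix_mulVec_eq_zero_iff {R : Type*} [Ring R] [IsDomain R] {P Q : R[X]}
    (hP : P ≠ 0) (hQ : Q ≠ 0) :
    (∃ v, v ≠ 0 ∧ (sylvesterMatrix P.natDegree Q.natDegree P.coeff Q.coeff).mulVec v = 0) ↔
      ∃ H K : R[X], H ≠ 0 ∧ K ≠ 0 ∧ H.natDegree < Q.natDegree ∧ K.natDegree < P.natDegree ∧
        P * H + Q * K = 0 := by
  set n := P.natDegree
  set m := Q.natDegree
  constructor
  · rintro ⟨v, hv, hAv⟩
    have hcomb : P * ∑ p : Fin m, monomial (p : ℕ) (v (Fin.castAdd n p)) +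
        Q * ∑ p : Fin n, monomial (p : ℕ) (v (Fin.natAdd m p)) = 0 := by
      ext i
      by_cases hi : i < m + n
      · rw [← sylvesterMatrix_mulVec P Q n m v ⟨i, hi⟩, hAv]
        simp
      -- The matrix has no row for `i ≥ m + n`. There `i - p` exceeds `n` when `p < m`, and exceeds
      -- `m` when `p < n`.
      · rw [coeff_add, coeff_mul_sum_monomial, coeff_mul_sum_monomial, coeff_zero,
          Finset.sum_eq_zero, Finset.sum_eq_zero, add_zero]
        · intro p _
          rw [coeff_eq_zero_of_natDegree_lt (p := Q) (by have := p.2; omega)]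
          simp
        · intro p _
          rw [coeff_eq_zero_of_natDegree_lt (p := P) (by have := p.2; omega)]
          simp
    set H := ∑ p : Fin m, monomial (p : ℕ) (v (Fin.castAdd n p)) with hH
    set K := ∑ p : Fin n, monomial (p : ℕ) (v (Fin.natAdd m p)) with hK
    have hHc : ∀ p : Fin m, H.coeff p = v (Fin.castAdd n p) := fun p => by
      simp [hH, coeff_monomial, Fin.val_inj]
    have hKc : ∀ p : Fin n, K.coeff p = v (Fin.natAdd m p) := fun p => by
      simp [hK, coeff_monomial, Fin.val_inj]
    -- If one of them vanishes, the syzygy is a single product equal to zero in a domain.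
    have hHK : H = 0 ↔ K = 0 := by
      constructor <;> intro h <;> simpa [h, hP, hQ] using hcomb
    have hH0 : H ≠ 0 := by
      intro h
      apply hv
      funext i
      refine Fin.addCases (fun p => ?_) (fun p => ?_) i
      · rw [← hHc, h]; simp
      · rw [← hKc, hHK.1 h]; simp
    have hK0 := mt hHK.2 hH0
    exact ⟨H, K, hH0, hK0, natDegree_sum_monomial_lt _ hH0, natDegree_sum_monomial_lt _ hK0,
      hcomb⟩
  · rintro ⟨H, K, hH0, -, hH, hK, h⟩
    refine ⟨Fin.addCases (fun p => H.coeff p) (fun p => K.coeff p), ?_, ?_⟩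
    · intro hz
      apply hH0
      ext i
      by_cases hi : i < m
      · have := congrFun hz (Fin.castAdd n ⟨i, hi⟩)
        rwa [Fin.addCases_left] at this
      · exact coeff_eq_zero_of_natDegree_lt (by omega)
    · funext i
      rw [sylvesterMatrix_mulVec]
      simp only [Fin.addCases_left, Fin.addCases_right]
      -- The degree bounds ensure that the first `m` coefficients of `H` and the first `n` of `K`
      -- recover both polynomials.
      rw [← Finset.sum_range fun p => monomial p (H.coeff p),
        ← Finset.sum_range fun p => monomial p (K.coeff p), ← as_sum_range' H m hH,
        ← as_sum_range' K n hK, h]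
      simp

/-! ### Two-variable polynomials as iterated polynomials. -/

open Polynomial in
/-- Polynomials in two commuting variables as iterated polynomials. -/
def bivariateRingEquiv (R : Type*) [Semiring R] : AddMonoidAlgebra R (ℕ × ℕ) ≃+* R[X][X] :=
  (AddMonoidAlgebra.curryRingEquiv.trans
    (AddMonoidAlgebra.mapRingEquiv ℕ (toFinsuppIso R).symm)).trans (toFinsuppIso R[X]).symm

theorem coeff_coeff_bivariateRingEquiv {R : Type*} [Semiring R]
    (a : AddMonoidAlgebra R (ℕ × ℕ)) (n m : ℕ) :
    ((bivariateRingEquiv R a).coeff n).coeff m = a.coeff (n, m) := by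
  simp [bivariateRingEquiv, Polynomial.coeff, AddMonoidAlgebra.curryRingEquiv,
    AddMonoidAlgebra.curryAddEquiv]

namespace SlicePoly₂

/-- The family of coefficients as a ring isomorphism. -/
def coeffsRingEquiv : SlicePoly₂ ≃+* AddMonoidAlgebra ℍ[ℝ] (ℕ × ℕ) :=
  ofCoeffs.symm.ringEquiv

open Polynomial in
/-- `ℍ[q₁, q₂]` as polynomials in `q₁` with coefficients in `ℍ[q₂]`. -/
def toPolyQ₁ : SlicePoly₂ ≃+* ℍ[ℝ][X][X] :=
  coeffsRingEquiv.trans (bivariateRingEquiv ℍ[ℝ])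

open Polynomial in
/-- `ℍ[q₁, q₂]` as polynomials in `q₂` with coefficients in `ℍ[q₁]`. -/
def toPolyQ₂ : SlicePoly₂ ≃+* ℍ[ℝ][X][X] :=
  -- Exchanging the exponents is an automorphism of the monoid `ℕ × ℕ`, so it respects convolution.
  (coeffsRingEquiv.trans (AddMonoidAlgebra.mapDomainRingEquiv ℍ[ℝ]
    (AddEquiv.prodComm (M := ℕ) (N := ℕ)))).trans (bivariateRingEquiv ℍ[ℝ])

theorem coeff_coeff_toPolyQ₁ (P : SlicePoly₂) (n m : ℕ) :
    ((toPolyQ₁ P).coeff n).coeff m = P.coeff n m :=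
  coeff_coeff_bivariateRingEquiv _ n m

theorem coeff_coeff_toPolyQ₂ (P : SlicePoly₂) (n m : ℕ) :
    ((toPolyQ₂ P).coeff m).coeff n = P.coeff n m := by
  refine (coeff_coeff_bivariateRingEquiv _ m n).trans ?_
  simp [coeffsRingEquiv, coeff]

theorem coeff_eq_zero_of_degQ₁_lt {P : SlicePoly₂} {n : ℕ} (h : P.degQ₁ < n) (m : ℕ) :
    P.coeff n m = 0 := by
  by_contra hc
  have := Finset.le_sup (f := Prod.fst) (Finsupp.mem_support_iff.2 hc)
  exact absurd h (not_lt.2 this)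

theorem coeff_eq_zero_of_degQ₂_lt {P : SlicePoly₂} {m : ℕ} (h : P.degQ₂ < m) (n : ℕ) :
    P.coeff n m = 0 := by
  by_contra hc
  have := Finset.le_sup (f := Prod.snd) (Finsupp.mem_support_iff.2 hc)
  exact absurd h (not_lt.2 this)

theorem natDegree_toPolyQ₁ (P : SlicePoly₂) : (toPolyQ₁ P).natDegree = P.degQ₁ := by
  apply le_antisymm
  · refine Polynomial.natDegree_le_iff_coeff_eq_zero.2 fun n hn => ?_
    ext1 m
    rw [coeff_coeff_toPolyQ₁, coeff_eq_zero_of_degQ₁_lt hn, Polynomial.coeff_zero]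
  · refine Finset.sup_le fun nm h => Polynomial.le_natDegree_of_ne_zero fun hz => ?_
    apply Finsupp.mem_support_iff.1 h
    change P.coeff nm.1 nm.2 = 0
    rw [← coeff_coeff_toPolyQ₁, hz, Polynomial.coeff_zero]

theorem natDegree_toPolyQ₂ (P : SlicePoly₂) : (toPolyQ₂ P).natDegree = P.degQ₂ := by
  apply le_antisymm
  · refine Polynomial.natDegree_le_iff_coeff_eq_zero.2 fun m hm => ?_
    ext1 n
    rw [coeff_coeff_toPolyQ₂, coeff_eq_zero_of_degQ₂_lt hm, Polynomial.coeff_zero]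
  · refine Finset.sup_le fun nm h => Polynomial.le_natDegree_of_ne_zero fun hz => ?_
    apply Finsupp.mem_support_iff.1 h
    change P.coeff nm.1 nm.2 = 0
    rw [← coeff_coeff_toPolyQ₂, hz, Polynomial.coeff_zero]

theorem coeff_toPolyQ₁ (P : SlicePoly₂) : (toPolyQ₁ P).coeff = P.coeffQ₁ := by
  funext k
  ext1 m
  rw [coeff_coeff_toPolyQ₁, coeffQ₁, Polynomial.finsetSum_coeff]
  simp only [Polynomial.coeff_monomial, Finset.sum_ite_eq', Finset.mem_range]
  split_ifs with h
  · rfl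
  -- The sum defining `coeffQ₁` stops at `degQ₂`, beyond which every coefficient vanishes.
  · exact coeff_eq_zero_of_degQ₂_lt (by omega) k

theorem coeff_toPolyQ₂ (P : SlicePoly₂) : (toPolyQ₂ P).coeff = P.coeffQ₂ := by
  funext k
  ext1 n
  rw [coeff_coeff_toPolyQ₂, coeffQ₂, Polynomial.finsetSum_coeff]
  simp only [Polynomial.coeff_monomial, Finset.sum_ite_eq', Finset.mem_range]
  split_ifs with h
  · rfl
  · exact coeff_eq_zero_of_degQ₁_lt (by omega) k

end SlicePoly₂

/-! ### Vanishing of the regular resultants. -/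

/-- A ring isomorphism onto `ℍ[X][Y]` turns low degree syzygies into low degree syzygies. -/
theorem exists_syzygy_iff_of_ringEquiv {S T : Type*} [Ring S] [Ring T]
    (e : S ≃+* Polynomial T) (deg : S → ℕ) (hdeg : ∀ P, (e P).natDegree = deg P) (P Q : S) :
    (∃ H K : Polynomial T, H ≠ 0 ∧ K ≠ 0 ∧ H.natDegree < (e Q).natDegree ∧
      K.natDegree < (e P).natDegree ∧ e P * H + e Q * K = 0) ↔
    ∃ H K : S, H ≠ 0 ∧ K ≠ 0 ∧ deg H < deg Q ∧ deg K < deg P ∧ P * H + Q * K = 0 := by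
  rw [e.surjective.exists]
  refine exists_congr fun H => ?_
  rw [e.surjective.exists]
  refine exists_congr fun K => ?_
  rw [← map_mul, ← map_mul, ← map_add]
  simp only [hdeg, ne_eq, EmbeddingLike.map_eq_zero_iff]

open Polynomial in
theorem dieudonneDet_sylvesterMatrix_eq_zero_iff {P Q : ℍ[ℝ][X][X]} (hP : P ≠ 0) (hQ : Q ≠ 0) :
    dieudonneDet _ ((sylvesterMatrix P.natDegree Q.natDegree P.coeff Q.coeff).map
      SemiRegular.ofPolynomial) = 0 ↔
      ∃ H K : ℍ[ℝ][X][X], H ≠ 0 ∧ K ≠ 0 ∧ H.natDegree < Q.natDegree ∧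
        K.natDegree < P.natDegree ∧ P * H + Q * K = 0 :=
  (dieudonneDet_map_eq_zero_iff SemiRegular.ofPolynomial SemiRegular.ofPolynomial_injective
    exists_mul_mem_center _).trans (exists_sylvesterMatrix_mulVec_eq_zero_iff hP hQ)

theorem lemma4p3 (P Q : SlicePoly₂) (hP : P ≠ 0) (hQ : Q ≠ 0) :
    (P.resQ₁ Q = 0 ↔
      ∃ H K : SlicePoly₂, H ≠ 0 ∧ K ≠ 0 ∧ H.degQ₁ < Q.degQ₁ ∧ K.degQ₁ < P.degQ₁ ∧
        P * H + Q * K = 0) ∧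
    (P.resQ₂ Q = 0 ↔
      ∃ H K : SlicePoly₂, H ≠ 0 ∧ K ≠ 0 ∧ H.degQ₂ < Q.degQ₂ ∧ K.degQ₂ < P.degQ₂ ∧
        P * H + Q * K = 0) := by
  constructor
  · rw [← exists_syzygy_iff_of_ringEquiv SlicePoly₂.toPolyQ₁ _ SlicePoly₂.natDegree_toPolyQ₁,
      ← dieudonneDet_sylvesterMatrix_eq_zero_iff
        ((map_ne_zero_iff _ SlicePoly₂.toPolyQ₁.injective).2 hP)
        ((map_ne_zero_iff _ SlicePoly₂.toPolyQ₁.injective).2 hQ),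
      SlicePoly₂.natDegree_toPolyQ₁, SlicePoly₂.natDegree_toPolyQ₁, SlicePoly₂.coeff_toPolyQ₁,
      SlicePoly₂.coeff_toPolyQ₁]
    rfl
  · rw [← exists_syzygy_iff_of_ringEquiv SlicePoly₂.toPolyQ₂ _ SlicePoly₂.natDegree_toPolyQ₂,
      ← dieudonneDet_sylvesterMatrix_eq_zero_iff
        ((map_ne_zero_iff _ SlicePoly₂.toPolyQ₂.injective).2 hP)
        ((map_ne_zero_iff _ SlicePoly₂.toPolyQ₂.injective).2 hQ),
      SlicePoly₂.natDegree_toPolyQ₂, SlicePoly₂.natDegree_toPolyQ₂, SlicePoly₂.coeff_toPolyQ₂,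
      SlicePoly₂.coeff_toPolyQ₂]
    rfl

end
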